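/- Let $X$ be a finite set of node features and let $\mathbb{G}^n$ be the set of (simple, undirected) graphs with at most $n$ nodes, each node carrying a feature in $X$. An \emph{EDU-QGC} with $q$ qubits per node (so that a node has the state space $\mathbb{C}^s$ with computational basis indexed by $q$-bit strings, $s=2^q$) is a finite composition of layers, fixed independently of the input graph; on a graph with $m$ nodes and edge set $\mathcal{E}$ each layer acts on $(\mathbb{C}^s)^{\otimes m}$ and is either a node layer $V^{\otimes m}$, with $V$ a unitary on $\mathbb{C}^s$, or an edge layer $\prod_{\{j,k\}\in\mathcal{E}}U_{jk}$, where $U_{jk}$ is $U$ applied to the nodes $j,k$ and $U=(W^\dagger\otimes W^\dagger)D(W\otimes W)$ with $W$ unitary, $D$ a diagonal unitary and $\mathrm{SWAP}\,U\,\mathrm{SWAP}=U$. Let $C(G)$ denote the resulting unitary. Then for every isomorphism-invariant function $f:\mathbb{G}^n\to\mathbb{R}$ and every $\epsilon>0$, $f$ can be represented by an EDU-QGC with error probability $\epsilon$. That is, there are a number $q$ of qubits per node, an EDU-QGC $C$ with $q$ qubits per node, a feature map $\rho$ from $X$ to unit vectors of $\mathbb{C}^s$, and a classical aggregation function $g$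 from finite multisets of $q$-bit strings to $\mathbb{R}$ such that for every $G\in\mathbb{G}^n$ with nodes $1,\dots,m$ and features $x_1,\dots,x_m$, measuring the state $C(G)\,\bigotimes_{i=1}^m|\rho(x_i)\rangle$ in the computational basis, with outcomes $y_1,\dots,y_m$ at the nodes, gives \[ \Pr\big[g(\{\!\!\{y_1,\dots,y_m\}\!\!\})=f(G)\big]\ \ge\ 1-\epsilon . \] -/

import Mathlib

noncomputable section

open Matrix Finset
open scoped Kronecker

/-- Computational basis of one node register made of `q` qubits (dimension `s = 2 ^ q`). -/
abbrev NodeBasis (q : ℕ) : Type := Fin q → Bool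

/-- Computational basis of the joint system of `m` nodes with `q` qubits each
(dimension `s ^ m`). -/
abbrev Config (m q : ℕ) : Type := Fin m → NodeBasis q

/-! ### Graphs of bounded size with node features -/

/-- A simple undirected graph with at most `n` nodes whose nodes carry features in `X`. -/
structure BoundedGraph (X : Type*) (n : ℕ) where
  size : ℕ
  size_le : size ≤ n
  graph : SimpleGraph (Fin size)
  feat : Fin size → X

/-- Isomorphism of graphs with node features. -/
def BoundedGraph.Isomorphic {X : Type*} {n : ℕ} (G H : BoundedGraph X n) : Prop :=
  ∃ φ : G.graph ≃g H.graph, ∀ i, H.feat (φ i) = G.feat i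

/-- A function on graphs: a function of the representations `BoundedGraph` that takes the same
value on isomorphic graphs. -/
def IsGraphInvariant {X : Type*} {n : ℕ} (f : BoundedGraph X n → ℝ) : Prop :=
  ∀ G H : BoundedGraph X n, G.Isomorphic H → f G = f H

/-! ### Equivariant quantum graph circuits -/

/-- An equivariant quantum graph circuit with `q` qubits per node (at fixed parameter values):
a unitary for every graph on `m` nodes, equivariant under reordering of the nodes. -/
structure EQGC (q : ℕ) where
  mat : (m : ℕ) → SimpleGraph (Fin m) → Matrix (Config m q) (Config m q) ℂ
  unitary : ∀ m G, mat m G ∈ Matrix.unitaryGroup (Config m q) ℂ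
  equivariant : ∀ m (G : SimpleGraph (Fin m)) (σ : Equiv.Perm (Fin m)) (y x : Config m q),
    mat m (G.comap σ) (fun i => y (σ i)) (fun i => x (σ i)) = mat m G y x

/-- The product state `⨂ i, |ρ (x i)⟩`. -/
def productState {X : Type*} {m q : ℕ} (ρ : X → NodeBasis q → ℂ) (feat : Fin m → X) :
    Config m q → ℂ :=
  fun y => ∏ i, ρ (feat i) (y i)

/-- Born rule: the probability of measuring `y` in the computational basis. -/
def EQGC.measureProb {X : Type*} {n q : ℕ} (C : EQGC q) (ρ : X → NodeBasis q → ℂ)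
    (G : BoundedGraph X n) (y : Config G.size q) : ℝ :=
  ‖(C.mat G.size G.graph *ᵥ productState ρ G.feat) y‖ ^ 2

/-- The probability that the model with feature map `ρ`, circuit `C` and permutation-invariant
classical aggregation `g` (a function of the multiset of measured node states) outputs `r`
on the input `G`. -/
def EQGC.outputProb {X : Type*} {n q : ℕ} (C : EQGC q) (ρ : X → NodeBasis q → ℂ)
    (g : Multiset (NodeBasis q) → ℝ) (G : BoundedGraph X n) (r : ℝ) : ℝ :=
  ∑ y : Config G.size q with g (Finset.univ.val.map y) = r, C.measureProb ρ G y

/-- `f` can be represented by `C` with error probability (at most) `ε`: for some feature map into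
normalised one-node states and some invariant classical aggregation function, the output on every
input graph `G` is `f G` with probability at least `1 - ε`. -/
def EQGC.Represents {X : Type*} {n q : ℕ} (C : EQGC q) (f : BoundedGraph X n → ℝ) (ε : ℝ) :
    Prop :=
  ∃ ρ : X → NodeBasis q → ℂ, (∀ x, ∑ b, ‖ρ x b‖ ^ 2 = 1) ∧
    ∃ g : Multiset (NodeBasis q) → ℝ,
      ∀ G : BoundedGraph X n, 1 - ε ≤ C.outputProb ρ g G (f G)

/-! ### Node layers and edge layers -/

/-- The same one-node operator on all `m` nodes: `V^{⊗ m}`. -/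
def tensorPow {q : ℕ} (m : ℕ) (V : Matrix (NodeBasis q) (NodeBasis q) ℂ) :
    Matrix (Config m q) (Config m q) ℂ :=
  Matrix.of fun y x => ∏ i, V (y i) (x i)

/-- The two-node operator `U` applied to the nodes `j` and `k` (in this order), with the identity
on all other nodes. Used for `j ≠ k` only. -/
def twoNode {q m : ℕ} (U : Matrix (NodeBasis q × NodeBasis q) (NodeBasis q × NodeBasis q) ℂ)
    (j k : Fin m) : Matrix (Config m q) (Config m q) ℂ :=
  Matrix.of fun y x =>
    if ∀ i, i ≠ j → i ≠ k → y i = x i then U (y j, y k) (x j, x k) else 0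

/-- Equivariantly diagonalizable unitaries: `(V† ⊗ V†) D (V ⊗ V)` with `V` unitary and `D`
a diagonal unitary. -/
def IsEDU {q : ℕ}
    (U : Matrix (NodeBasis q × NodeBasis q) (NodeBasis q × NodeBasis q) ℂ) : Prop :=
  ∃ V ∈ Matrix.unitaryGroup (NodeBasis q) ℂ, ∃ d : NodeBasis q × NodeBasis q → ℂ,
    (∀ p, ‖d p‖ = 1) ∧ U = (Vᴴ ⊗ₖ Vᴴ) * Matrix.diagonal d * (V ⊗ₖ V)

/-- The condition for undirected edges: `SWAP U SWAP = U`. -/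
def IsSwapSymmetric {q : ℕ}
    (U : Matrix (NodeBasis q × NodeBasis q) (NodeBasis q × NodeBasis q) ℂ) : Prop :=
  U.submatrix Prod.swap Prod.swap = U

theorem twoNode_comm {q m : ℕ}
    {U : Matrix (NodeBasis q × NodeBasis q) (NodeBasis q × NodeBasis q) ℂ}
    (hs : IsSwapSymmetric U) (j k : Fin m) : twoNode U j k = twoNode U k j := by
  ext y x
  have h := congrFun (congrFun hs (y k, y j)) (x k, x j)
  simp only [Matrix.submatrix_apply, Prod.swap_prod_mk] at h
  simp only [twoNode, Matrix.of_apply, h]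
  congr 1
  exact propext ⟨fun H i a b => H i b a, fun H i a b => H i b a⟩

/-- `U` applied to the two ends of an undirected edge. -/
def edgeOp {q m : ℕ} (U : Matrix (NodeBasis q × NodeBasis q) (NodeBasis q × NodeBasis q) ℂ)
    (hs : IsSwapSymmetric U) : Sym2 (Fin m) → Matrix (Config m q) (Config m q) ℂ :=
  Sym2.lift ⟨twoNode U, twoNode_comm hs⟩

theorem tensorPow_mul {q m : ℕ} (A B : Matrix (NodeBasis q) (NodeBasis q) ℂ) :
    tensorPow m A * tensorPow m B = tensorPow m (A * B) := by
  ext y x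
  simp only [tensorPow, Matrix.mul_apply, Matrix.of_apply, ← Finset.prod_mul_distrib]
  rw [Finset.prod_univ_sum, Fintype.piFinset_univ]

theorem tensorPow_one {q m : ℕ} :
    tensorPow m (1 : Matrix (NodeBasis q) (NodeBasis q) ℂ) = 1 := by
  ext y x
  simp only [tensorPow, Matrix.of_apply, Matrix.one_apply]
  rw [Fintype.prod_ite_zero]
  simp [funext_iff]

theorem tensorPow_conjTranspose {q m : ℕ} (V : Matrix (NodeBasis q) (NodeBasis q) ℂ) :
    (tensorPow m V)ᴴ = tensorPow m Vᴴ := by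
  ext y x
  simp [tensorPow, Matrix.conjTranspose_apply]

theorem tensorPow_mem_unitaryGroup {q m : ℕ} {V : Matrix (NodeBasis q) (NodeBasis q) ℂ}
    (hV : V ∈ Matrix.unitaryGroup (NodeBasis q) ℂ) :
    tensorPow m V ∈ Matrix.unitaryGroup (Config m q) ℂ := by
  rw [Matrix.mem_unitaryGroup_iff] at hV ⊢
  rw [Matrix.star_eq_conjTranspose] at hV ⊢
  rw [tensorPow_conjTranspose, tensorPow_mul, hV, tensorPow_one]

theorem twoNode_diagonalize {q m : ℕ} {V : Matrix (NodeBasis q) (NodeBasis q) ℂ}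
    (hV : V ∈ Matrix.unitaryGroup (NodeBasis q) ℂ) (d : NodeBasis q × NodeBasis q → ℂ)
    {j k : Fin m} (hjk : j ≠ k) :
    twoNode ((Vᴴ ⊗ₖ Vᴴ) * Matrix.diagonal d * (V ⊗ₖ V)) j k =
      tensorPow m Vᴴ * Matrix.diagonal (fun x : Config m q => d (x j, x k)) *
        tensorPow m V := by
  have hV' : Vᴴ * V = 1 := (Matrix.mem_unitaryGroup_iff'.1 hV)
  ext y x
  set F : NodeBasis q → NodeBasis q → Fin m → NodeBasis q → ℂ := fun a b i c =>
    Vᴴ (y i) c * V c (x i) *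
      ((if i = j then (if c = a then 1 else 0) else 1) *
        (if i = k then (if c = b then 1 else 0) else 1)) with hF
  have hR : (tensorPow m Vᴴ * Matrix.diagonal (fun x : Config m q => d (x j, x k)) *
        tensorPow m V) y x = ∑ a, ∑ b, d (a, b) * ∑ z : Config m q, ∏ i, F a b i (z i) := by
    rw [Matrix.mul_apply]
    simp only [Matrix.mul_diagonal, tensorPow, Matrix.of_apply, Finset.mul_sum]
    rw [Finset.sum_comm' (t' := Finset.univ) (s' := fun _ => Finset.univ) (by simp)]
    have : ∀ b, ∑ a, ∑ z : Config m q, d (a, b) * ∏ i, F a b i (z i) =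
        ∑ z : Config m q, ∑ a, d (a, b) * ∏ i, F a b i (z i) := fun b => Finset.sum_comm
    simp only [this]
    rw [Finset.sum_comm]
    refine Finset.sum_congr rfl fun z _ => ?_
    simp only [hF, Finset.prod_mul_distrib, Finset.prod_ite_eq', Finset.mem_univ, if_true]
    rw [Finset.sum_comm]
    simp only [mul_ite, mul_one, mul_zero, Finset.sum_ite_eq, Finset.mem_univ, if_true]
    ring
  rw [hR]
  have hFs : ∀ a b, ∑ z : Config m q, ∏ i, F a b i (z i) =
      if ∀ i, i ≠ j → i ≠ k → y i = x i then
        (Vᴴ (y j) a * V a (x j)) * (Vᴴ (y k) b * V b (x k)) else 0 := by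
    intro a b
    have h1 := Finset.prod_univ_sum (fun _ : Fin m => (Finset.univ : Finset (NodeBasis q)))
      (fun i c => F a b i c)
    rw [Fintype.piFinset_univ] at h1
    rw [← h1, ← Finset.mul_prod_erase _ _ (Finset.mem_univ j),
      ← Finset.mul_prod_erase _ _ (show k ∈ Finset.univ.erase j by simp [hjk.symm])]
    have hj : ∑ c, F a b j c = Vᴴ (y j) a * V a (x j) := by
      simp [hF, hjk]
    have hk : ∑ c, F a b k c = Vᴴ (y k) b * V b (x k) := by
      simp [hF, hjk.symm]
    have ho : ∏ i ∈ (Finset.univ.erase j).erase k, ∑ c, F a b i c =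
        ∏ i ∈ (Finset.univ.erase j).erase k, if y i = x i then (1 : ℂ) else 0 := by
      refine Finset.prod_congr rfl fun i hi => ?_
      simp only [Finset.mem_erase, Finset.mem_univ, and_true] at hi
      have := congrFun (congrFun hV' (y i)) (x i)
      rw [Matrix.mul_apply, Matrix.one_apply] at this
      simp [hF, hi.1, hi.2, ← this]
    rw [hj, hk, ho, Finset.prod_ite_zero]
    have hiff : (∀ i ∈ (Finset.univ.erase j).erase k, y i = x i) ↔
        (∀ i, i ≠ j → i ≠ k → y i = x i) := by
      simp only [Finset.mem_erase, Finset.mem_univ, and_true, and_imp]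
      exact ⟨fun H i p r => H i r p, fun H i p r => H i r p⟩
    simp only [hiff, Finset.prod_const_one]
    split_ifs <;> ring
  simp only [hFs, twoNode, Matrix.of_apply]
  split_ifs with h
  · rw [Matrix.mul_apply]
    simp only [Matrix.mul_diagonal, Matrix.kroneckerMap_apply, Fintype.sum_prod_type]
    refine Finset.sum_congr rfl fun a _ => Finset.sum_congr rfl fun b _ => ?_
    ring
  · simp

/-- The diagonal phase attached to an undirected edge by a symmetric diagonal. -/
theorem IsEDU.exists_edgeOp {q m : ℕ}
    {U : Matrix (NodeBasis q × NodeBasis q) (NodeBasis q × NodeBasis q) ℂ}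
    (hU : IsEDU U) (hs : IsSwapSymmetric U) :
    ∃ V ∈ Matrix.unitaryGroup (NodeBasis q) ℂ, ∃ d : NodeBasis q × NodeBasis q → ℂ,
      (∀ p, ‖d p‖ = 1) ∧ (∀ a b, d (a, b) = d (b, a)) ∧
      ∀ j k : Fin m, j ≠ k → edgeOp U hs s(j, k) =
        tensorPow m Vᴴ * Matrix.diagonal (fun x : Config m q => d (x j, x k)) *
          tensorPow m V := by
  obtain ⟨V, hV, d, hd, rfl⟩ := hU
  refine ⟨V, hV, d, hd, ?_, fun j k hjk => twoNode_diagonalize hV d hjk⟩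
  have hV1 : Vᴴ * V = 1 := Matrix.mem_unitaryGroup_iff'.1 hV
  have hV2 : V * Vᴴ = 1 := Matrix.mem_unitaryGroup_iff.1 hV
  have hsw : ∀ A : Matrix (NodeBasis q) (NodeBasis q) ℂ,
      (A ⊗ₖ A).submatrix Prod.swap Prod.swap = A ⊗ₖ A := by
    intro A
    ext ⟨a, b⟩ ⟨c, e⟩
    simp [Matrix.kroneckerMap_apply, mul_comm]
  have key : ((Vᴴ ⊗ₖ Vᴴ) * Matrix.diagonal (d ∘ Prod.swap) * (V ⊗ₖ V)) =
      (Vᴴ ⊗ₖ Vᴴ) * Matrix.diagonal d * (V ⊗ₖ V) := by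
    have h := hs
    unfold IsSwapSymmetric at h
    have e : (Prod.swap : NodeBasis q × NodeBasis q → _) =
      (Equiv.prodComm (NodeBasis q) (NodeBasis q)) := rfl
    rw [← h, e, ← Matrix.submatrix_mul_equiv _ _ _ (Equiv.prodComm _ _) _,
      ← Matrix.submatrix_mul_equiv _ _ _ (Equiv.prodComm _ _) _,
      Matrix.submatrix_diagonal_equiv, ← e, hsw, hsw]
  have k1 : (V ⊗ₖ V) * (Vᴴ ⊗ₖ Vᴴ) = 1 := by
    rw [← Matrix.mul_kronecker_mul, hV2, Matrix.one_kronecker_one]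
  have key2 : Matrix.diagonal (d ∘ Prod.swap) = Matrix.diagonal d := by
    calc Matrix.diagonal (d ∘ Prod.swap)
        = ((V ⊗ₖ V) * (Vᴴ ⊗ₖ Vᴴ)) * Matrix.diagonal (d ∘ Prod.swap) *
            ((V ⊗ₖ V) * (Vᴴ ⊗ₖ Vᴴ)) := by rw [k1, one_mul, mul_one]
      _ = (V ⊗ₖ V) * ((Vᴴ ⊗ₖ Vᴴ) * Matrix.diagonal (d ∘ Prod.swap) * (V ⊗ₖ V)) *
            (Vᴴ ⊗ₖ Vᴴ) := by simp only [Matrix.mul_assoc]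
      _ = (V ⊗ₖ V) * ((Vᴴ ⊗ₖ Vᴴ) * Matrix.diagonal d * (V ⊗ₖ V)) *
            (Vᴴ ⊗ₖ Vᴴ) := by rw [key]
      _ = ((V ⊗ₖ V) * (Vᴴ ⊗ₖ Vᴴ)) * Matrix.diagonal d *
            ((V ⊗ₖ V) * (Vᴴ ⊗ₖ Vᴴ)) := by simp only [Matrix.mul_assoc]
      _ = _ := by rw [k1, one_mul, mul_one]
  intro a b
  exact (congrFun (Matrix.diagonal_injective key2) (b, a))

theorem edgeOp_commute {q m : ℕ}
    {U : Matrix (NodeBasis q × NodeBasis q) (NodeBasis q × NodeBasis q) ℂ}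
    (hU : IsEDU U) (hs : IsSwapSymmetric U) {e e' : Sym2 (Fin m)}
    (he : ¬ e.IsDiag) (he' : ¬ e'.IsDiag) : Commute (edgeOp U hs e) (edgeOp U hs e') := by
  obtain ⟨V, hV, d, -, -, H⟩ := hU.exists_edgeOp (m := m) hs
  induction e with | _ j k => ?_
  induction e' with | _ j' k' => ?_
  rw [Sym2.mk_isDiag_iff] at he he'
  rw [H j k he, H j' k' he']
  have hT : tensorPow m V * tensorPow m Vᴴ = 1 := by
    rw [tensorPow_mul, ← tensorPow_one]
    exact congrArg _ (Matrix.mem_unitaryGroup_iff.1 hV)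
  have : ∀ D D' : Matrix (Config m q) (Config m q) ℂ,
      tensorPow m Vᴴ * D * tensorPow m V * (tensorPow m Vᴴ * D' * tensorPow m V) =
        tensorPow m Vᴴ * (D * D') * tensorPow m V := by
    intro D D'
    calc _ = tensorPow m Vᴴ * D * (tensorPow m V * tensorPow m Vᴴ) * D' * tensorPow m V := by
          simp only [Matrix.mul_assoc]
      _ = _ := by rw [hT, mul_one, Matrix.mul_assoc _ D D']
  unfold Commute SemiconjBy
  rw [this, this, Matrix.diagonal_mul_diagonal, Matrix.diagonal_mul_diagonal]
  simp only [mul_comm]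

open scoped Classical in
/-- The edge layer `∏_{(j,k) ∈ E} U_{jk}`; the factors commute, so that the product does not depend
on an order of the edges. -/
def edgeLayer {q : ℕ} (U : Matrix (NodeBasis q × NodeBasis q) (NodeBasis q × NodeBasis q) ℂ)
    (hU : IsEDU U) (hs : IsSwapSymmetric U) (m : ℕ) (G : SimpleGraph (Fin m)) :
    Matrix (Config m q) (Config m q) ℂ :=
  G.edgeFinset.noncommProd (edgeOp U hs) (fun _ he _ he' _ =>
    edgeOp_commute hU hs
      (G.not_isDiag_of_mem_edgeSet (SimpleGraph.mem_edgeFinset.1 (Finset.mem_coe.1 he)))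
      (G.not_isDiag_of_mem_edgeSet (SimpleGraph.mem_edgeFinset.1 (Finset.mem_coe.1 he'))))

/-- A layer of an EDU-QGC (on undirected graphs): one unitary applied to every node, or one
equivariantly diagonalizable unitary applied to every edge. -/
inductive EDULayer (q : ℕ) : Type
  | node (V : Matrix (NodeBasis q) (NodeBasis q) ℂ)
      (hV : V ∈ Matrix.unitaryGroup (NodeBasis q) ℂ) : EDULayer q
  | edge (U : Matrix (NodeBasis q × NodeBasis q) (NodeBasis q × NodeBasis q) ℂ)
      (hU : IsEDU U) (hs : IsSwapSymmetric U) : EDULayer q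

/-- The operator of a layer on a given graph. -/
def EDULayer.mat {q : ℕ} (L : EDULayer q) (m : ℕ) (G : SimpleGraph (Fin m)) :
    Matrix (Config m q) (Config m q) ℂ :=
  match L with
  | .node V _ => tensorPow m V
  | .edge U hU hs => edgeLayer U hU hs m G

/-! ### Layers are unitary and equivariant -/

open scoped Classical in
theorem edgeLayer_eq {q : ℕ}
    {U : Matrix (NodeBasis q × NodeBasis q) (NodeBasis q × NodeBasis q) ℂ}
    (hU : IsEDU U) (hs : IsSwapSymmetric U) (m : ℕ) :
    ∃ V ∈ Matrix.unitaryGroup (NodeBasis q) ℂ, ∃ D : Sym2 (Fin m) → Config m q → ℂ,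
      (∀ e x, ‖D e x‖ = 1) ∧
      (∀ (σ : Equiv.Perm (Fin m)) e x, D e (fun i => x (σ i)) = D (e.map σ) x) ∧
      ∀ G : SimpleGraph (Fin m), edgeLayer U hU hs m G =
        tensorPow m Vᴴ * Matrix.diagonal (fun x => ∏ e ∈ G.edgeFinset, D e x) *
          tensorPow m V := by
  obtain ⟨V, hV, d, hd, hds, H⟩ := hU.exists_edgeOp (m := m) hs
  have hT : tensorPow m V * tensorPow m Vᴴ = 1 := by
    rw [tensorPow_mul, ← tensorPow_one]
    exact congrArg _ (Matrix.mem_unitaryGroup_iff.1 hV)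
  have hT' : tensorPow m Vᴴ * tensorPow m V = 1 := by
    rw [tensorPow_mul, ← tensorPow_one]
    exact congrArg _ (Matrix.mem_unitaryGroup_iff'.1 hV)
  refine ⟨V, hV, fun e x => Sym2.lift ⟨fun j k => d (x j, x k), fun j k => hds _ _⟩ e,
    ?_, ?_, ?_⟩
  · intro e x
    induction e with | _ j k => exact hd _
  · intro σ e x
    induction e with | _ j k => rfl
  · intro G
    have aux : ∀ (s : Finset (Sym2 (Fin m))) (hsd : ∀ e ∈ s, ¬ e.IsDiag)
        (hc : (s : Set (Sym2 (Fin m))).Pairwise (Function.onFun Commute (edgeOp U hs))),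
        s.noncommProd (edgeOp U hs) hc = tensorPow m Vᴴ * Matrix.diagonal (fun x => ∏ e ∈ s,
          Sym2.lift ⟨fun j k => d (x j, x k), fun j k => hds _ _⟩ e) * tensorPow m V := by
      intro s
      induction s using Finset.induction_on with
      | empty =>
        intro _ _
        simp [hT']
      | insert e s hes ih =>
        intro hsd hc
        rw [Finset.noncommProd_insert_of_notMem _ _ _ _ hes,
          ih (fun e' h' => hsd e' (Finset.mem_insert_of_mem h'))]
        have he := hsd e (Finset.mem_insert_self _ _)
        have hop : edgeOp U hs e = tensorPow m Vᴴ * Matrix.diagonal (fun x : Config m q =>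
            Sym2.lift ⟨fun j k => d (x j, x k), fun j k => hds _ _⟩ e) * tensorPow m V := by
          induction e with | _ j k => exact H j k (by simpa using he)
        rw [hop]
        simp only [Finset.prod_insert hes]
        rw [← Matrix.diagonal_mul_diagonal]
        generalize Matrix.diagonal (fun x : Config m q =>
          Sym2.lift ⟨fun j k => d (x j, x k), fun j k => hds _ _⟩ e) = D
        generalize Matrix.diagonal (fun x : Config m q => ∏ e ∈ s,
          Sym2.lift ⟨fun j k => d (x j, x k), fun j k => hds _ _⟩ e) = D'
        calc _ = tensorPow m Vᴴ * D * (tensorPow m V * tensorPow m Vᴴ) * D' *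
                tensorPow m V := by simp only [Matrix.mul_assoc]
          _ = _ := by rw [hT, mul_one, Matrix.mul_assoc _ D D']
    exact aux _ (fun e he => G.not_isDiag_of_mem_edgeSet (SimpleGraph.mem_edgeFinset.1 he)) _

theorem EDULayer.mat_mem_unitaryGroup {q : ℕ} (L : EDULayer q) (m : ℕ)
    (G : SimpleGraph (Fin m)) : L.mat m G ∈ Matrix.unitaryGroup (Config m q) ℂ := by
  classical
  cases L with
  | node V hV => exact tensorPow_mem_unitaryGroup hV
  | edge U hU hs =>
    obtain ⟨V, hV, D, hD, -, H⟩ := edgeLayer_eq hU hs m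
    have h1 : tensorPow m V ∈ Matrix.unitaryGroup (Config m q) ℂ :=
      tensorPow_mem_unitaryGroup hV
    have h2 : tensorPow m Vᴴ ∈ Matrix.unitaryGroup (Config m q) ℂ := by
      rw [← tensorPow_conjTranspose]
      exact Unitary.star_mem h1
    change edgeLayer U hU hs m G ∈ _
    rw [H G]
    refine mul_mem (mul_mem h2 ?_) h1
    rw [Matrix.mem_unitaryGroup_iff, Matrix.star_eq_conjTranspose,
      Matrix.diagonal_conjTranspose, Matrix.diagonal_mul_diagonal, ← Matrix.diagonal_one]
    congr 1
    funext x
    have : ‖∏ e ∈ G.edgeFinset, D e x‖ = 1 := by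
      rw [norm_prod]
      exact Finset.prod_eq_one fun e _ => hD e x
    rw [Pi.star_apply, ← starRingEnd_apply, Complex.mul_conj', this]
    simp

theorem EDULayer.mat_equivariant {q : ℕ} (L : EDULayer q) (m : ℕ) (G : SimpleGraph (Fin m))
    (σ : Equiv.Perm (Fin m)) (y x : Config m q) :
    L.mat m (G.comap σ) (fun i => y (σ i)) (fun i => x (σ i)) = L.mat m G y x := by
  classical
  have hT : ∀ (V : Matrix (NodeBasis q) (NodeBasis q) ℂ) (y x : Config m q),
      tensorPow m V (fun i => y (σ i)) (fun i => x (σ i)) = tensorPow m V y x :=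
    fun V y x => Equiv.prod_comp σ fun i => V (y i) (x i)
  cases L with
  | node V hV => exact hT V y x
  | edge U hU hs =>
    obtain ⟨V, hV, D, -, hD, H⟩ := edgeLayer_eq hU hs m
    change edgeLayer U hU hs m (G.comap σ) _ _ = edgeLayer U hU hs m G y x
    rw [H, H, Matrix.mul_apply, Matrix.mul_apply]
    simp only [Matrix.mul_diagonal]
    rw [← Equiv.sum_comp (Equiv.arrowCongr σ.symm (Equiv.refl (NodeBasis q)))]
    refine Finset.sum_congr rfl fun z _ => ?_
    have hz : (Equiv.arrowCongr σ.symm (Equiv.refl (NodeBasis q))) z = fun i => z (σ i) := by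
      funext i
      simp [Equiv.arrowCongr]
    rw [hz, hT, hT]
    congr 2
    simp only [hD]
    refine Finset.prod_bij (fun e _ => e.map σ) ?_ ?_ ?_ (fun _ _ => rfl)
    · intro e he
      induction e with | _ j k => simpa using he
    · intro e _ e' _ h
      exact Sym2.map.injective σ.injective h
    · intro e he
      refine ⟨e.map σ.symm, ?_, ?_⟩
      · induction e with | _ j k => simpa using he
      · induction e with | _ j k => simp

/-- An equivariantly diagonalizable unitary quantum graph circuit with `q` qubits per node:
a finite sequence of node layers and edge layers, the same for all graphs. -/
abbrev EDUQGC (q : ℕ) : Type := List (EDULayer q)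

/-- The circuit as an EQGC: the composition `L₁ ∘ … ∘ L_k` of its layers (the last one in the list
acts first). -/
def EDUQGC.toEQGC {q : ℕ} (C : EDUQGC q) : EQGC q where
  mat m G := (C.map fun L => L.mat m G).prod
  unitary m G := by
    refine list_prod_mem fun M hM => ?_
    obtain ⟨L, -, rfl⟩ := List.mem_map.1 hM
    exact L.mat_mem_unitaryGroup m G
  equivariant m G σ := by
    induction C with
    | nil =>
      intro y x
      have : (fun i => y (σ i)) = (fun i => x (σ i)) ↔ y = x :=
        ⟨fun h => funext fun i => by simpa using congrFun h (σ.symm i), fun h => by rw [h]⟩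
      simp [Matrix.one_apply, this]
    | cons L C ih =>
      intro y x
      simp only [List.map_cons, List.prod_cons, Matrix.mul_apply]
      rw [← Equiv.sum_comp (Equiv.arrowCongr σ.symm (Equiv.refl (NodeBasis q)))]
      refine Finset.sum_congr rfl fun z _ => ?_
      have hz : (Equiv.arrowCongr σ.symm (Equiv.refl (NodeBasis q))) z = fun i => z (σ i) := by
        funext i
        simp [Equiv.arrowCongr]
      rw [hz, L.mat_equivariant m G σ y z, ih z x]

end

open Finset Matrix
open scoped Kronecker

/-! ### The Walsh–Hadamard matrix on `I → Bool` -/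

/-! The measured multiset determines the graph up to isomorphism once every node reports its
feature, a label that no other node has, and the labels of its neighbours. A node is therefore split
into an encoded feature in `A`, a label in `I`, and a register with one bit per label. The feature
is fixed; label and register start in uniform superposition.

For every ordered adjacent pair `(i, k)` a diagonal gate contributes the sign given by the bit of
the register of `i` at the label of `k`. Labels are untouched, and a Walsh–Hadamard transform of the
registers turns the accumulated signs into the parity vectors of the neighbours' labels
(`walsh_neighborLabels`). So each labelling of the `m` nodes is observed, together with its parity
vectors, with probability exactly `|I|⁻ᵐ` (`labelCircuit_mulVec`).

If the labels are distinct, the parity vector of a node is the indicator of its neighbourhood, so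
the multiset can be decoded (`isomorphic_of_map_labelConfig_eq`). Errors come only from label
collisions, whose probability is at most `m² / |I|` (`one_sub_le_card_embedding_div`), hence at most
`ε` for large `I`. -/

/-- The sign `(-1) ^ b` of a bit. -/
def bitSign (b : Bool) : ℂ := if b then -1 else 1

theorem norm_bitSign (b : Bool) : ‖bitSign b‖ = 1 := by
  cases b <;> simp [bitSign]

theorem bitSign_pow (b : Bool) (k : ℕ) : bitSign b ^ k = bitSign (b && decide (Odd k)) := by
  cases b
  · simp [bitSign]
  · rcases Nat.even_or_odd k with h | h
    · simp [bitSign, h.neg_one_pow, Nat.not_odd_iff_even.2 h]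
    · simp [bitSign, h.neg_one_pow, h]

/-- The Walsh–Hadamard matrix on bit vectors indexed by `I`. -/
noncomputable def walsh (I : Type*) [Fintype I] : Matrix (I → Bool) (I → Bool) ℂ :=
  Matrix.of fun r p => ∏ c, ((√2 : ℝ) : ℂ)⁻¹ * bitSign (r c && p c)

theorem inv_sqrt_two_mul_self : ((√2 : ℝ) : ℂ)⁻¹ * ((√2 : ℝ) : ℂ)⁻¹ = 2⁻¹ := by
  rw [← mul_inv, ← Complex.ofReal_mul, Real.mul_self_sqrt (by norm_num)]
  norm_num

theorem walsh_mul_self (I : Type*) [Fintype I] [DecidableEq I] : walsh I * walsh I = 1 := by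
  ext r p
  have h : ∀ b b' : Bool, ∑ z : Bool, (((√2 : ℝ) : ℂ)⁻¹ * bitSign (b && z)) *
      (((√2 : ℝ) : ℂ)⁻¹ * bitSign (z && b')) = if b = b' then 1 else 0 := by
    intro b b'
    have h2 := inv_sqrt_two_mul_self
    cases b <;> cases b' <;> simp [bitSign, h2] <;> norm_num
  simp only [walsh, Matrix.mul_apply, Matrix.of_apply, ← Finset.prod_mul_distrib]
  rw [← Fintype.piFinset_univ, ← Finset.prod_univ_sum (fun _ => Finset.univ)
    (fun c z => (((√2 : ℝ) : ℂ)⁻¹ * bitSign (r c && z)) *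
      (((√2 : ℝ) : ℂ)⁻¹ * bitSign (z && p c)))]
  simp only [h, Matrix.one_apply, Fintype.prod_ite_zero, Finset.prod_const_one, funext_iff]

theorem walsh_conjTranspose (I : Type*) [Fintype I] : (walsh I)ᴴ = walsh I := by
  ext r p
  simp only [walsh, Matrix.conjTranspose_apply, Matrix.of_apply, star_prod, star_mul']
  refine Finset.prod_congr rfl fun c _ => ?_
  cases r c <;> cases p c <;> simp [bitSign]

/-- The parity vector of the labels of the neighbours of `i`. -/
noncomputable def neighborLabels {V I : Type*} (G : SimpleGraph V) (a : V → I) (i : V) : I → Bool :=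
  open scoped Classical in fun c => decide (Odd (Nat.card {k // G.Adj i k ∧ a k = c}))

/-- Only `k` itself carries the label `a k`, so the count whose parity is taken is 0 or 1. -/
theorem neighborLabels_apply_of_injective {V I : Type*} (G : SimpleGraph V) {a : V → I}
    (ha : Function.Injective a) (i k : V) : neighborLabels G a i (a k) = true ↔ G.Adj i k := by
  classical
  by_cases h : G.Adj i k
  · have : Unique {l // G.Adj i l ∧ a l = a k} :=
      ⟨⟨⟨k, h, rfl⟩⟩, fun l => Subtype.ext (ha l.2.2)⟩
    simp [neighborLabels, h]
  · have : IsEmpty {l // G.Adj i l ∧ a l = a k} :=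
      ⟨fun l => h (ha l.2.2 ▸ l.2.1)⟩
    simp [neighborLabels, h]

-- Phase kickback: grouping the neighbours by label, the sign at label `c` occurs once per neighbour
-- labelled `c`, so only the parity of their number survives. The signs thus form a column of the
-- Walsh matrix.
open scoped Classical in
theorem walsh_neighborLabels {V I : Type*} [Fintype V] [Fintype I] (G : SimpleGraph V)
    (a : V → I) (i : V) (r : I → Bool) :
    (∏ k, if G.Adj i k then bitSign (r (a k)) else 1) * (((√2 : ℝ) : ℂ)⁻¹) ^ Fintype.card I =
      walsh I r (neighborLabels G a i) := by
  rw [← Finset.card_univ, ← Finset.prod_const, walsh, Matrix.of_apply, Finset.prod_mul_distrib,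
    mul_comm]
  congr 1
  rw [← Finset.prod_fiberwise univ a]
  refine Finset.prod_congr rfl fun c _ => ?_
  rw [neighborLabels, ← bitSign_pow, ← Finset.prod_filter, Finset.filter_filter,
    Finset.prod_congr rfl (g := fun _ => bitSign (r c)), Finset.prod_const]
  · congr 1
    rw [Nat.card_eq_fintype_card, Fintype.card_subtype]
    simp only [and_comm]
  · intro k hk
    rw [(Finset.mem_filter.1 hk).2.1]

/-! ### Diagonal edge layers -/

-- Each edge is the image of exactly two ordered pairs. This lets a phase that treats the two ends
-- differently be realised by a swap-symmetric gate.
open scoped Classical in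
theorem SimpleGraph.prod_edgeFinset_lift {m : ℕ} (G : SimpleGraph (Fin m))
    (F : Fin m → Fin m → ℂ) :
    ∏ e ∈ G.edgeFinset, Sym2.lift ⟨fun j k => F j k * F k j, fun _ _ => mul_comm _ _⟩ e =
      ∏ i, ∏ k, if G.Adj i k then F i k else 1 := by
  rw [← Finset.prod_product', Finset.univ_product_univ, ← Finset.prod_filter]
  rw [← Finset.prod_fiberwise_of_maps_to (g := fun p : Fin m × Fin m => s(p.1, p.2))
    (t := G.edgeFinset) (by simp)]
  refine Finset.prod_congr rfl fun e he => ?_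
  induction e with | _ j k => ?_
  have hjk : G.Adj j k := by simpa using he
  have : {p ∈ ({p | G.Adj p.1 p.2} : Finset (Fin m × Fin m)) | s(p.1, p.2) = s(j, k)} =
      {(j, k), (k, j)} := by
    ext ⟨a, b⟩
    simp only [mem_filter, mem_univ, true_and, Sym2.eq_iff, mem_insert, mem_singleton,
      Prod.mk.injEq]
    constructor
    · exact fun h => h.2
    · rintro (⟨rfl, rfl⟩ | ⟨rfl, rfl⟩)
      · exact ⟨hjk, Or.inl ⟨rfl, rfl⟩⟩
      · exact ⟨hjk.symm, Or.inr ⟨rfl, rfl⟩⟩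
  rw [this, Finset.prod_pair]
  · rfl
  · intro h
    exact hjk.ne (Prod.mk.inj h).1

theorem isEDU_diagonal {q : ℕ} {d : NodeBasis q × NodeBasis q → ℂ} (hd : ∀ p, ‖d p‖ = 1) :
    IsEDU (Matrix.diagonal d) :=
  ⟨1, one_mem _, d, hd, by simp⟩

theorem isSwapSymmetric_diagonal {q : ℕ} {d : NodeBasis q × NodeBasis q → ℂ}
    (hd : ∀ a b, d (a, b) = d (b, a)) : IsSwapSymmetric (Matrix.diagonal d) := by
  change (Matrix.diagonal d).submatrix (Equiv.prodComm _ _) (Equiv.prodComm _ _) = _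
  rw [Matrix.submatrix_diagonal_equiv]
  congr 1
  funext p
  exact hd _ _

theorem twoNode_diagonal {q m : ℕ} (d : NodeBasis q × NodeBasis q → ℂ) {j k : Fin m}
    (hjk : j ≠ k) :
    twoNode (Matrix.diagonal d) j k = Matrix.diagonal fun x : Config m q => d (x j, x k) := by
  have h := twoNode_diagonalize (V := (1 : Matrix (NodeBasis q) (NodeBasis q) ℂ)) (one_mem _) d hjk
  simpa [tensorPow_one] using h

open scoped Classical in
theorem edgeLayer_diagonal {q : ℕ} (φ : NodeBasis q → NodeBasis q → ℂ)
    (hU : IsEDU (Matrix.diagonal fun p : NodeBasis q × NodeBasis q => φ p.1 p.2 * φ p.2 p.1))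
    (hs : IsSwapSymmetric
      (Matrix.diagonal fun p : NodeBasis q × NodeBasis q => φ p.1 p.2 * φ p.2 p.1))
    (m : ℕ) (G : SimpleGraph (Fin m)) :
    edgeLayer _ hU hs m G = Matrix.diagonal fun x : Config m q =>
      ∏ i, ∏ k, if G.Adj i k then φ (x i) (x k) else 1 := by
  set D : Sym2 (Fin m) → Config m q → ℂ := fun e x => Sym2.lift
    ⟨fun j k => φ (x j) (x k) * φ (x k) (x j), fun _ _ => mul_comm _ _⟩ e with hD
  have h1 : ∀ e ∈ G.edgeFinset, edgeOp _ hs e = Matrix.diagonalRingHom (Config m q) ℂ (D e) := by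
    intro e he
    have he := G.not_isDiag_of_mem_edgeSet (SimpleGraph.mem_edgeFinset.1 he)
    induction e with | _ j k => exact twoNode_diagonal _ (by simpa using he)
  refine (Finset.noncommProd_congr rfl h1 _).trans ?_
  rw [← Finset.map_noncommProd _ _ (fun _ _ _ _ _ => Commute.all _ _), Finset.noncommProd_eq_prod]
  change Matrix.diagonal (∏ e ∈ G.edgeFinset, D e) = _
  congr 1
  funext x
  rw [Finset.prod_apply]
  exact G.prod_edgeFinset_lift fun j k => φ (x j) (x k)

/-! ### The circuit that records the labels of the neighbours -/

section Register

variable {q : ℕ} {A I : Type*} [Fintype I]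

/-- The phase that correlates the register of one node with the label of another node. -/
noncomputable def labelPhase (e : NodeBasis q ≃ A × I × (I → Bool)) (y z : NodeBasis q) : ℂ :=
  bitSign ((e y).2.2 (e z).2.1)

/-- The Walsh–Hadamard matrix on the third component of a node. -/
noncomputable def registerWalsh [DecidableEq A] [DecidableEq I]
    (e : NodeBasis q ≃ A × I × (I → Bool)) : Matrix (NodeBasis q) (NodeBasis q) ℂ :=
  ((1 : Matrix A A ℂ) ⊗ₖ ((1 : Matrix I I ℂ) ⊗ₖ walsh I)).submatrix e e

theorem registerWalsh_mem_unitaryGroup [Fintype A] [DecidableEq A] [DecidableEq I]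
    (e : NodeBasis q ≃ A × I × (I → Bool)) :
    registerWalsh e ∈ Matrix.unitaryGroup (NodeBasis q) ℂ := by
  rw [Matrix.mem_unitaryGroup_iff, Matrix.star_eq_conjTranspose, registerWalsh,
    Matrix.conjTranspose_submatrix, Matrix.submatrix_mul_equiv, Matrix.conjTranspose_kronecker,
    Matrix.conjTranspose_kronecker, walsh_conjTranspose, ← Matrix.mul_kronecker_mul,
    ← Matrix.mul_kronecker_mul, walsh_mul_self]
  simp

/-- The circuit that writes the labels of the neighbours of every node into its register. -/
noncomputable def labelCircuit [Fintype A] [DecidableEq A] [DecidableEq I]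
    (e : NodeBasis q ≃ A × I × (I → Bool)) : EDUQGC q :=
  -- The edge layer, last in the list, acts first. No earlier Walsh layer is needed, since
  -- `labelState` is already uniform on the register.
  [.node (registerWalsh e) (registerWalsh_mem_unitaryGroup e),
    .edge (Matrix.diagonal fun p => labelPhase e p.1 p.2 * labelPhase e p.2 p.1)
      (isEDU_diagonal fun p => by simp [labelPhase, norm_bitSign])
      (isSwapSymmetric_diagonal fun _ _ => mul_comm _ _)]

/-- The initial state of a node: the encoded feature, and uniform superpositions of the labels and
of the register contents. -/
noncomputable def labelState {X : Type*} [DecidableEq A] (e : NodeBasis q ≃ A × I × (I → Bool))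
    (enc : X → A) (x : X) (y : NodeBasis q) : ℂ :=
  if (e y).1 = enc x then
    ((√(Fintype.card I : ℝ) : ℝ) : ℂ)⁻¹ * (((√2 : ℝ) : ℂ)⁻¹) ^ Fintype.card I else 0

theorem sum_norm_labelState_sq {X : Type*} [Fintype A] [DecidableEq A] [DecidableEq I] [Nonempty I]
    (e : NodeBasis q ≃ A × I × (I → Bool)) (enc : X → A) (x : X) :
    ∑ y, ‖labelState e enc x y‖ ^ 2 = 1 := by
  rw [← Equiv.sum_comp e.symm, Fintype.sum_prod_type]
  have hI : (Fintype.card I : ℝ) ≠ 0 := by simp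
  simp only [labelState, Equiv.apply_symm_apply]
  have hnorm : ‖((√(Fintype.card I : ℝ) : ℝ) : ℂ)⁻¹ * (((√2 : ℝ) : ℂ)⁻¹) ^ Fintype.card I‖ ^ 2 =
      (Fintype.card I : ℝ)⁻¹ * (2 ^ Fintype.card I)⁻¹ := by
    rw [norm_mul, norm_pow, norm_inv, norm_inv, Complex.norm_real, Complex.norm_real,
      Real.norm_of_nonneg (Real.sqrt_nonneg _), Real.norm_of_nonneg (Real.sqrt_nonneg _), mul_pow,
      ← pow_mul, mul_comm (Fintype.card I) 2, pow_mul, inv_pow, inv_pow, inv_pow,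
      Real.sq_sqrt (by positivity), Real.sq_sqrt (by positivity)]
  simp only [apply_ite norm, norm_zero, ite_pow, hnorm]
  simp
  field_simp

/-- The configuration with given node features, labels, and neighbour labels in the registers. -/
noncomputable def labelConfig {X : Type*} {m : ℕ} (e : NodeBasis q ≃ A × I × (I → Bool))
    (enc : X → A) (G : SimpleGraph (Fin m)) (feat : Fin m → X) (a : Fin m → I) : Config m q :=
  fun i => e.symm (enc (feat i), a i, neighborLabels G a i)

/-- The amplitude is a sum over intermediate configurations. Once the labels are pinned to `a`, the
summand is a product over nodes, and each node contributes a diagonal entry of the squared Walsh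
matrix, which is 1, times the label amplitude. -/
theorem labelCircuit_mulVec {X : Type*} [Fintype A] [DecidableEq A] [DecidableEq I] {m : ℕ}
    (e : NodeBasis q ≃ A × I × (I → Bool)) (enc : X → A)
    (G : SimpleGraph (Fin m)) (feat : Fin m → X) (a : Fin m → I) :
    ((labelCircuit e).toEQGC.mat m G *ᵥ productState (labelState e enc) feat)
      (labelConfig e enc G feat a) = (((√(Fintype.card I : ℝ) : ℝ) : ℂ)⁻¹) ^ m := by
  classical
  have hmat : (labelCircuit e).toEQGC.mat m G = tensorPow m (registerWalsh e) *
      Matrix.diagonal fun x : Config m q =>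
        ∏ i, ∏ k, if G.Adj i k then labelPhase e (x i) (x k) else 1 := by
    simp only [labelCircuit, EDUQGC.toEQGC, List.map_cons, List.map_nil, List.prod_cons,
      List.prod_nil, mul_one, EDULayer.mat]
    rw [edgeLayer_diagonal]
  set c : ℂ := ((√(Fintype.card I : ℝ) : ℝ) : ℂ)⁻¹ with hc
  set y := labelConfig e enc G feat a with hy
  have hye : ∀ i, e (y i) = (enc (feat i), a i, neighborLabels G a i) := fun i => by
    simp [hy, labelConfig]
  have hterm : ∀ z : Config m q, tensorPow m (registerWalsh e) y z *
      ((∏ i, ∏ k, if G.Adj i k then labelPhase e (z i) (z k) else 1) *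
        productState (labelState e enc) feat z) =
      ∏ i, c * (if enc (feat i) = (e (z i)).1 ∧ a i = (e (z i)).2.1 then
        walsh I (neighborLabels G a i) (e (z i)).2.2 *
          walsh I (e (z i)).2.2 (neighborLabels G a i) else 0) := by
    intro z
    simp only [tensorPow, Matrix.of_apply, productState, ← Finset.prod_mul_distrib]
    -- The phases couple different nodes only through the labels. If features and labels agree with
    -- the outcome, factor `i` depends on `z i` alone; otherwise an identity block of
    -- `registerWalsh` kills both sides.
    by_cases hz : ∀ i, enc (feat i) = (e (z i)).1 ∧ a i = (e (z i)).2.1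
    · refine Finset.prod_congr rfl fun i _ => ?_
      rw [if_pos (hz i), ← walsh_neighborLabels, labelState, if_pos (hz i).1.symm]
      have hw : registerWalsh e (y i) (z i) = walsh I (neighborLabels G a i) (e (z i)).2.2 := by
        simp [registerWalsh, Matrix.kroneckerMap_apply, hye, (hz i).1, Matrix.one_apply,
          ← (hz i).2]
      simp only [hw, labelPhase, ← (hz _).2]
      ring
    · push Not at hz
      obtain ⟨i, hi⟩ := hz
      rw [Finset.prod_eq_zero (mem_univ i), Finset.prod_eq_zero (mem_univ i)]
      · rw [if_neg (fun h => hi h.1 h.2), mul_zero]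
      · simp only [registerWalsh, Matrix.submatrix_apply, Matrix.kroneckerMap_apply, hye,
          Matrix.one_apply]
        by_cases h1 : enc (feat i) = (e (z i)).1
        · simp [hi h1]
        · simp [h1]
  rw [hmat, ← Matrix.mulVec_mulVec, Matrix.mulVec, dotProduct]
  simp only [Matrix.mulVec_diagonal, hterm]
  rw [← Fintype.piFinset_univ, ← Finset.prod_univ_sum (fun _ => Finset.univ)
    (fun i z => c * (if enc (feat i) = (e z).1 ∧ a i = (e z).2.1 then
        walsh I (neighborLabels G a i) (e z).2.2 *
          walsh I (e z).2.2 (neighborLabels G a i) else 0))]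
  have hone : ∀ i, ∑ z, c * (if enc (feat i) = (e z).1 ∧ a i = (e z).2.1 then
        walsh I (neighborLabels G a i) (e z).2.2 *
          walsh I (e z).2.2 (neighborLabels G a i) else 0) = c := by
    intro i
    have hw := congrFun (congrFun (walsh_mul_self I) (neighborLabels G a i)) (neighborLabels G a i)
    rw [Matrix.mul_apply, Matrix.one_apply_eq] at hw
    rw [← Finset.mul_sum, ← Equiv.sum_comp e.symm]
    simp only [Equiv.apply_symm_apply, Fintype.sum_prod_type, ite_and]
    simp [hw]
  simp only [hone, prod_const, card_univ, Fintype.card_fin]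

end Register

/-! ### Decoding -/

/-- Nodes with equal outcomes are matched; distinct labels make the matching injective, and
registers read at labels transfer adjacency. -/
theorem isomorphic_of_map_labelConfig_eq {X A I : Type*} {n q : ℕ}
    (e : NodeBasis q ≃ A × I × (I → Bool)) {enc : X → A} (henc : Function.Injective enc)
    {G H : BoundedGraph X n} {a : Fin G.size → I} {b : Fin H.size → I}
    (ha : Function.Injective a) (hb : Function.Injective b)
    (h : univ.val.map (labelConfig e enc G.graph G.feat a) =
      univ.val.map (labelConfig e enc H.graph H.feat b)) : G.Isomorphic H := by
  have hex : ∀ i, ∃ j, labelConfig e enc H.graph H.feat b j =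
      labelConfig e enc G.graph G.feat a i := by
    intro i
    have : labelConfig e enc G.graph G.feat a i ∈
        univ.val.map (labelConfig e enc G.graph G.feat a) :=
      Multiset.mem_map_of_mem _ (mem_univ_val i)
    rw [h] at this
    obtain ⟨j, -, hj⟩ := Multiset.mem_map.1 this
    exact ⟨j, hj⟩
  choose φ hφ using hex
  simp only [labelConfig, EmbeddingLike.apply_eq_iff_eq, Prod.mk.injEq] at hφ
  have hcard : Fintype.card (Fin G.size) = Fintype.card (Fin H.size) := by
    simpa using congrArg Multiset.card h
  have hinj : Function.Injective φ := fun i j hij => ha <| by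
    rw [← (hφ i).2.1, ← (hφ j).2.1, hij]
  refine ⟨⟨Equiv.ofBijective φ ((Fintype.bijective_iff_injective_and_card φ).2 ⟨hinj, hcard⟩),
    fun {i j} => ?_⟩, fun i => henc (hφ i).1⟩
  rw [← neighborLabels_apply_of_injective G.graph ha,
    ← neighborLabels_apply_of_injective H.graph hb, Equiv.ofBijective_apply,
    Equiv.ofBijective_apply, (hφ i).2.2, (hφ j).2.1]

/-! ### Success probability and choice of parameters -/

/-- The fraction of injective labellings. -/
theorem one_sub_le_card_embedding_div {m N : ℕ} (hm : m ≤ N) (hN : 0 < N) :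
    1 - (m : ℝ) ^ 2 / N ≤ (Fintype.card (Fin m ↪ Fin N) : ℝ) / (N : ℝ) ^ m := by
  have hN' : (0 : ℝ) < N := by exact_mod_cast hN
  have hmN : (m : ℝ) ≤ N := by exact_mod_cast hm
  -- Each of the `m` factors of the descending factorial is at least `N + 1 - m`.
  have h1 : ((N + 1 - m : ℕ) : ℝ) ^ m ≤ (Fintype.card (Fin m ↪ Fin N) : ℝ) := by
    rw [Fintype.card_embedding_eq, Fintype.card_fin, Fintype.card_fin]
    exact_mod_cast Nat.pow_sub_le_descFactorial N m
  -- Bernoulli's inequality.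
  have h2 : 1 + (m : ℝ) * (-(m / N)) ≤ (1 + -((m : ℝ) / N)) ^ m :=
    one_add_mul_le_pow (by linarith [(div_le_one hN').2 hmN]) m
  calc 1 - (m : ℝ) ^ 2 / N = 1 + (m : ℝ) * (-(m / N)) := by ring
    _ ≤ (1 + -((m : ℝ) / N)) ^ m := h2
    _ = ((N : ℝ) - m) ^ m / (N : ℝ) ^ m := by rw [← div_pow]; congr 1; field_simp; ring
    _ ≤ ((N + 1 - m : ℕ) : ℝ) ^ m / (N : ℝ) ^ m := by
      have h3 : (N : ℝ) - m ≤ ((N + 1 - m : ℕ) : ℝ) := by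
        rw [Nat.cast_sub (by omega)]
        push_cast
        linarith
      have h4 : 0 ≤ (N : ℝ) - m := by linarith
      gcongr
    _ ≤ _ := by gcongr

theorem represents_labelCircuit {X A I : Type*} [Fintype A] [DecidableEq A] [Fintype I]
    [DecidableEq I] [Nonempty I] {n q : ℕ} (e : NodeBasis q ≃ A × I × (I → Bool)) {enc : X → A}
    (henc : Function.Injective enc) {f : BoundedGraph X n → ℝ} (hf : IsGraphInvariant f) {ε : ℝ}
    (hn : n ≤ Fintype.card I) (hε : (n : ℝ) ^ 2 / Fintype.card I ≤ ε) :
    (labelCircuit e).toEQGC.Represents f ε := by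
  classical
  -- The aggregation picks any graph and injective labelling producing the multiset; which one is
  -- irrelevant by invariance of `f`. The default 0 is never used in the bound.
  refine ⟨labelState e enc, sum_norm_labelState_sq e enc, fun S =>
    if h : ∃ (G : BoundedGraph X n) (a : Fin G.size ↪ I),
      univ.val.map (labelConfig e enc G.graph G.feat a) = S then f h.choose else 0, fun G => ?_⟩
  have hI : (0 : ℝ) < Fintype.card I := by exact_mod_cast Fintype.card_pos
  have hemb : Fintype.card (Fin G.size ↪ I) = Fintype.card (Fin G.size ↪ Fin (Fintype.card I)) := by
    simp [Fintype.card_embedding_eq]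
  -- Different labellings are different outcomes, so their probabilities add up.
  have hinj : Function.Injective
      fun a : Fin G.size ↪ I => labelConfig e enc G.graph G.feat a := by
    intro a b hab
    ext i
    have := congrFun hab i
    simp only [labelConfig, EmbeddingLike.apply_eq_iff_eq, Prod.mk.injEq] at this
    exact this.2.1
  calc 1 - ε ≤ 1 - (G.size : ℝ) ^ 2 / Fintype.card I := by
        have : (G.size : ℝ) ≤ n := by exact_mod_cast G.size_le
        have : (G.size : ℝ) ^ 2 / Fintype.card I ≤ (n : ℝ) ^ 2 / Fintype.card I := by gcongr
        linarith
    _ ≤ (Fintype.card (Fin G.size ↪ I) : ℝ) / (Fintype.card I : ℝ) ^ G.size := by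
        rw [hemb]
        exact one_sub_le_card_embedding_div (G.size_le.trans hn) Fintype.card_pos
    _ = ∑ a : Fin G.size ↪ I, (labelCircuit e).toEQGC.measureProb (labelState e enc) G
          (labelConfig e enc G.graph G.feat a) := by
        simp only [EQGC.measureProb, labelCircuit_mulVec, sum_const, card_univ, nsmul_eq_mul,
          norm_pow, norm_inv, Complex.norm_real, Real.norm_eq_abs, abs_of_nonneg (Real.sqrt_nonneg _)]
        rw [← pow_mul, mul_comm G.size, pow_mul, inv_pow, Real.sq_sqrt hI.le, inv_pow,
          div_eq_mul_inv]
    _ = ∑ y ∈ univ.map ⟨_, hinj⟩, (labelCircuit e).toEQGC.measureProb (labelState e enc) G y := by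
        rw [sum_map]; rfl
    _ ≤ _ := by
        refine sum_le_sum_of_subset_of_nonneg ?_ fun y _ _ => sq_nonneg _
        intro y hy
        obtain ⟨a, -, rfl⟩ := mem_map.1 hy
        have h : ∃ (H : BoundedGraph X n) (b : Fin H.size ↪ I),
            univ.val.map (labelConfig e enc H.graph H.feat b) =
              univ.val.map (labelConfig e enc G.graph G.feat a) := ⟨G, a, rfl⟩
        refine mem_filter.2 ⟨mem_univ _, ?_⟩
        refine (dif_pos h).trans (hf _ _ ?_)
        obtain ⟨b, hb⟩ := h.choose_spec
        exact isomorphic_of_map_labelConfig_eq e henc b.injective a.injective hb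

theorem theorem3 {X : Type*} [Finite X] (n : ℕ) (f : BoundedGraph X n → ℝ)
    (hf : IsGraphInvariant f) (ε : ℝ) (hε : 0 < ε) :
    ∃ (q : ℕ) (C : EDUQGC q), C.toEQGC.Represents f ε := by
  cases nonempty_fintype X
  set p := Fintype.card X
  obtain ⟨l₀, hl₀⟩ := exists_nat_gt ((n : ℝ) ^ 2 / ε)
  set l := max n l₀
  have hl : n ≤ 2 ^ l := (le_max_left n l₀).trans Nat.lt_two_pow_self.le
  have hl' : (n : ℝ) ^ 2 / ε ≤ (2 ^ l : ℕ) :=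
    hl₀.le.trans (by exact_mod_cast (le_max_right n l₀).trans Nat.lt_two_pow_self.le)
  -- `p` qubits hold the feature in one-hot encoding, `l` the label, and `2 ^ l` one bit for each
  -- possible label.
  have e : NodeBasis (p + l + 2 ^ l) ≃
      (Fin p → Bool) × (Fin l → Bool) × ((Fin l → Bool) → Bool) :=
    Fintype.equivOfCardEq (by simp [pow_add, mul_assoc])
  have henc : Function.Injective fun x : X => fun i => decide (Fintype.equivFin X x = i) := by
    intro x y hxy
    have := congrFun hxy (Fintype.equivFin X x)
    simpa [eq_comm] using this
  refine ⟨_, labelCircuit e, represents_labelCircuit e henc hf (by simpa using hl) ?_⟩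
  have hcard : Fintype.card (Fin l → Bool) = 2 ^ l := by simp
  rw [hcard, div_le_comm₀ (by positivity) hε]
  exact hl'
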